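/- Let $1<\alpha\le 2$, $N\ge 0$, $a(0),\dots,a(N)\in\mathbb C$, and put $A_N(e^{i\theta})=\sum_{j=0}^N a(j)e^{ij\theta}$, and $z^{\langle\beta\rangle}=|z|^{\beta-1}\bar z$ for $z\in\mathbb C$, $\beta>0$. A harmonizable symmetric $\alpha$-stable sequence with spectral density $f$ is a sequence $\xi(n)=\int_{-\pi}^{\pi}e^{in\theta}\,dZ(\theta)$, $n\in\mathbb Z$, where $Z$ is a complex symmetric $\alpha$-stable process with independent increments and $\|Z(t)-Z(s)\|_\alpha^\alpha=\int_s^t f(\theta)\,d\theta$, and $\|\cdot\|_\alpha$ is the covariation norm ($\|X\|_\alpha^\alpha=[X,X]_\alpha$, the total mass of the spectral measure of $X$ on the unit circle). The functional $A_N\xi=\sum_{j=0}^N a(j)\xi(j)$ is to be estimated linearly from $\xi(j)$, $j\in\mathbb Z\setminus\{0,\dots,N\}$. For a spectral density $f\ge 0$ (integrable on $[-\pi,\pi]$) let $L_N^\alpha(f)$ be the closed span of $\{e^{ij\theta}: j\in\mathbb Z\setminus\{0,\dots,N\}\}$ in $L^\alpha(f\,d\theta)$, and let $$\Delta(h;f)=\int_{-\pi}^{\pi}|A_N(e^{i\theta})-h(\theta)|^\alpha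 f(\theta)\,d\theta .$$ Let $h(f)$ denote the minimizer of $\Delta(\cdot\,;f)$ over $L_N^\alpha(f)$ (the spectral characteristic of the optimal estimate), so that $\Delta(h(f);f)=\min_{h\in L_N^\alpha(f)}\Delta(h;f)$. For a class $D$ of spectral densities, $f_0\in D$ is called least favorable if $\Delta(h(f_0);f_0)=\max_{f\in D}\Delta(h(f);f)$, and $h^0$ is called a minimax spectral characteristic if $h^0\in H_D=\bigcap_{f\in D}L_N^\alpha(f)$ and $\max_{f\in D}\Delta(h^0;f)=\min_{h\in H_D}\sup_{f\in D}\Delta(h;f)$. Theorem. Let $P\in\mathbb R$ and $D_f^0=\{f:\int_{-\pi}^{\pi}f(\theta)\,d\theta=P\}$. Suppose that, for some $C\in\mathbb R$ and $c(0),\dots,c(N)\in\mathbb C$, the function $$f_0(\theta)=C\Bigl|\sum_{j=0}^N c(j)e^{-ij\theta}\Bigr|\quad\text{(for a.e. }\theta\in[-\pi,\pi])$$ is a spectral density in $D_f^0$, satisfies the minimality condition $\int_{-\pi}^{\pi}f_0(\theta)^{-1/(\alpha-1)}\,d\theta<\infty$, and satisfies $$\int_{-\pi}^{\pi}e^{-ik\theta}\Bigl[\sum_{j=0}^N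 a(j)e^{ij\theta}-\Bigl(f_0(\theta)^{-1}\sum_{j=0}^N c(j)e^{-ij\theta}\Bigr)^{\langle 1/(\alpha-1)\rangle}\Bigr]d\theta=0,\qquad k=0,\dots,N.$$ Then: 1. the spectral characteristic $h(f_0)$ exists, is unique up to equality a.e. with respect to $f_0\,d\theta$, and is $$h(f_0)(\theta)=A_N(e^{i\theta})-\Bigl(f_0(\theta)^{-1}\sum_{j=0}^N c(j)e^{-ij\theta}\Bigr)^{\langle 1/(\alpha-1)\rangle};$$ 2. $f_0$ is least favorable in $D_f^0$; 3. $h(f_0)$ is a minimax spectral characteristic for $D_f^0$ (in particular it lies in $H_{D_f^0}$). Here $\Delta(h;f)$ is indeed the error of estimation: if $\xi$ is a harmonizable symmetric $\alpha$-stable sequence with spectral density $f\in D_f^0$, $h\in L_N^\alpha(f)$, and $\eta$ is the linear estimate with spectral characteristic $h$ (that is, $\eta=\int_{-\pi}^{\pi}h\,dZ$, a limit in probability of finite linear combinations of the $\xi(j)$, $j\notin\{0,\dots,N\}$, whose images under $\xi(j)\leftrightarrow e^{ij\theta}$ converge to $h$ in $L^\alpha(f\,d\theta)$), then $A_N\xi-\eta$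 is symmetric $\alpha$-stable and $\|A_N\xi-\eta\|_\alpha^\alpha=\Delta(h;f)$. -/

import Mathlib

open MeasureTheory ProbabilityTheory Filter Topology
open scoped ENNReal ComplexConjugate

noncomputable section

namespace StableInterpolation

/-! ### Symmetric stable random variables and sequences -/

/-- `Γ` is the spectral measure of the complex symmetric `α`-stable random variable `X`: a finite
symmetric measure on the unit circle with
`E exp(i⟨X, w⟩) = exp(-∫ |⟨s, w⟩|^α dΓ(s))` for all `w`, where `⟨·, ·⟩` is the inner product of
`ℂ = ℝ²`. -/
structure HasStableSpectralMeasure {Ω : Type*} [MeasurableSpace Ω] (α : ℝ) (Pr : Measure Ω)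
    (X : Ω → ℂ) (Γ : Measure (Metric.sphere (0 : ℂ) 1)) : Prop where
  aemeasurable : AEMeasurable X Pr
  finite : IsFiniteMeasure Γ
  symmetric : Γ.map (fun s => -s) = Γ
  charFun_eq : ∀ w : ℂ, charFun (Pr.map X) w =
    Complex.exp (-((∫ s, |inner ℝ (s : ℂ) w| ^ α ∂Γ : ℝ) : ℂ))

/-- `X` is complex symmetric `α`-stable and `‖X‖_α^α = [X, X]_α = v`. As
`[X, X]_α = ∫ s s^{<α-1>} dΓ(s)` and `|s| = 1` on the circle, this is the total mass of the spectral
measure of `X`. -/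
def HasCovariationNormPow {Ω : Type*} [MeasurableSpace Ω] (α : ℝ) (Pr : Measure Ω)
    (X : Ω → ℂ) (v : ℝ≥0∞) : Prop :=
  ∃ Γ : Measure (Metric.sphere (0 : ℂ) 1), HasStableSpectralMeasure α Pr X Γ ∧ Γ Set.univ = v

/-- The absolutely continuous measure `f(θ) dθ` on `(-π, π]`. -/
def spectralMeasure (f : ℝ → ℝ) : Measure ℝ :=
  (volume.restrict (Set.Ioc (-Real.pi) Real.pi)).withDensity (fun θ => ENNReal.ofReal (f θ))

/-- The Riemann-Stieltjes sum of `g` over the partition of `[-π, π]` into `m` equal parts, with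
respect to the process `Z`. -/
def stieltjesSum {Ω : Type*} (Z : ℝ → Ω → ℂ) (g : ℝ → ℂ) (m : ℕ) (ω : Ω) : ℂ :=
  ∑ k ∈ Finset.range m,
    g (-Real.pi + 2 * Real.pi * k / m) *
      (Z (-Real.pi + 2 * Real.pi * (k + 1) / m) ω - Z (-Real.pi + 2 * Real.pi * k / m) ω)

/-- `ξ` is a harmonizable symmetric `α`-stable sequence with spectral density `f`:
`ξ(n) = ∫_{-π}^{π} e^{inθ} dZ(θ)` (a limit in probability of Riemann-Stieltjes sums) for a complex
symmetric `α`-stable process `Z` with independent increments whose spectral measure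
`μ((s, t]) = ‖Z(t) - Z(s)‖_α^α` has the density `f` on `(-π, π]` (and no mass elsewhere). -/
def IsHarmonizableStable {Ω : Type*} [MeasurableSpace Ω] (α : ℝ) (Pr : Measure Ω)
    (ξ : ℤ → Ω → ℂ) (f : ℝ → ℝ) : Prop :=
  ∃ Z : ℝ → Ω → ℂ,
    (∀ᵐ ω ∂Pr, Z (-Real.pi) ω = 0) ∧
    HasIndepIncrements Z Pr ∧
    (∀ s t : ℝ, s ≤ t →
      HasCovariationNormPow α Pr (fun ω => Z t ω - Z s ω) (spectralMeasure f (Set.Ioc s t))) ∧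
    ∀ n : ℤ, TendstoInMeasure Pr
      (fun m => stieltjesSum Z (fun θ => Complex.exp (n * θ * Complex.I)) m) atTop (ξ n)

/-! ### The spectral domain -/

/-- `∑_j b(j) e^{ijθ}` for finitely supported `b`. -/
def trigSum (b : ℤ →₀ ℂ) (θ : ℝ) : ℂ :=
  b.sum fun j z => z * Complex.exp (j * θ * Complex.I)

/-- `b` does not use the unobserved times `0, …, N`. -/
def IsObserved (N : ℕ) (b : ℤ →₀ ℂ) : Prop :=
  ∀ j ∈ b.support, j ∉ Set.Icc (0 : ℤ) N

/-- `L_N^α(f)`: the closed subspace of `L^α(f dθ)` generated by the functions `e^{ijθ}`,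
`j ∈ ℤ ∖ {0, …, N}`. -/
def observedSpace (α : ℝ) (N : ℕ) (f : ℝ → ℝ) : Set (ℝ → ℂ) :=
  {h | MemLp h (ENNReal.ofReal α) (spectralMeasure f) ∧
    ∀ ε : ℝ≥0∞, 0 < ε → ∃ b : ℤ →₀ ℂ, IsObserved N b ∧
      eLpNorm (fun θ => h θ - trigSum b θ) (ENNReal.ofReal α) (spectralMeasure f) < ε}

/-- `A_N(e^{iθ}) = ∑_{j=0}^N a(j) e^{ijθ}`. -/
def polyA (N : ℕ) (a : ℕ → ℂ) (θ : ℝ) : ℂ :=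
  ∑ j ∈ Finset.range (N + 1), a j * Complex.exp (j * θ * Complex.I)

/-- `C_N(e^{iθ}) = ∑_{j=0}^N c(j) e^{-ijθ}`. -/
def polyC (N : ℕ) (c : ℕ → ℂ) (θ : ℝ) : ℂ :=
  ∑ j ∈ Finset.range (N + 1), c j * Complex.exp (-(j * θ * Complex.I))

/-- `z^{<β>} = |z|^{β-1} z̄`. -/
def signedPow (z : ℂ) (β : ℝ) : ℂ := ((‖z‖ ^ (β - 1) : ℝ) : ℂ) * conj z

/-- `A_N(e^{iθ}) - (f(θ)⁻¹ C_N(e^{iθ}))^{<1/(α-1)>}`. -/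
def spectralCharacteristic (α : ℝ) (N : ℕ) (a c : ℕ → ℂ) (f : ℝ → ℝ) (θ : ℝ) : ℂ :=
  polyA N a θ - signedPow (((f θ)⁻¹ : ℝ) * polyC N c θ) (1 / (α - 1))

/-- The minimality condition `∫_{-π}^{π} f(θ)^{-1/(α-1)} dθ < ∞`, with value `+∞` of the
integrand where `f` vanishes. -/
def Minimality (α : ℝ) (f : ℝ → ℝ) : Prop :=
  ∫⁻ θ in Set.Ioc (-Real.pi) Real.pi, ENNReal.ofReal (f θ) ^ (-1 / (α - 1)) < ∞

/-- The error `Δ(h; f) = ∫_{-π}^{π} |A_N(e^{iθ}) - h(θ)|^α f(θ) dθ`. -/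
def estError (α : ℝ) (N : ℕ) (a : ℕ → ℂ) (h : ℝ → ℂ) (f : ℝ → ℝ) : ℝ≥0∞ :=
  ∫⁻ θ, ‖polyA N a θ - h θ‖ₑ ^ α ∂(spectralMeasure f)

/-- `h = h(f)`: `h` is the best approximation of `A_N(e^{iθ})` in `L_N^α(f)`, i.e. the spectral
characteristic of the optimal linear estimate when the spectral density is `f`. -/
def IsOptimalCharacteristic (α : ℝ) (N : ℕ) (a : ℕ → ℂ) (f : ℝ → ℝ) (h : ℝ → ℂ) : Prop :=
  h ∈ observedSpace α N f ∧ ∀ g ∈ observedSpace α N f, estError α N a h f ≤ estError α N a g f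

/-- The error `Δ(h(f); f)` of the optimal linear estimate when the spectral density is `f`. -/
def optimalError (α : ℝ) (N : ℕ) (a : ℕ → ℂ) (f : ℝ → ℝ) : ℝ≥0∞ :=
  ⨅ h ∈ observedSpace α N f, estError α N a h f

/-! ### Minimax notions -/

/-- The class of spectral densities on `(-π, π]` with `∫_{-π}^{π} f(θ) dθ = P`. -/
def densityClass (P : ℝ) : Set (ℝ → ℝ) :=
  {f | IntegrableOn f (Set.Ioc (-Real.pi) Real.pi) ∧
    (∀ᵐ θ ∂(volume.restrict (Set.Ioc (-Real.pi) Real.pi)), 0 ≤ f θ) ∧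
    ∫ θ in Set.Ioc (-Real.pi) Real.pi, f θ = P}

/-- `f₀` is least favorable in `D`: `f₀ ∈ D`, `h(f₀)` exists and
`Δ(h(f₀); f₀) = max_{f ∈ D} Δ(h(f); f)`. -/
def IsLeastFavorable (α : ℝ) (N : ℕ) (a : ℕ → ℂ) (D : Set (ℝ → ℝ)) (f₀ : ℝ → ℝ) : Prop :=
  f₀ ∈ D ∧ (∃ h, IsOptimalCharacteristic α N a f₀ h) ∧
    ∀ f ∈ D, optimalError α N a f ≤ optimalError α N a f₀

/-- `H_D = ⋂_{f ∈ D} L_N^α(f)`. -/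
def minimaxSpace (α : ℝ) (N : ℕ) (D : Set (ℝ → ℝ)) : Set (ℝ → ℂ) :=
  ⋂ f ∈ D, observedSpace α N f

/-- `h₀` is a minimax (robust) spectral characteristic for `D`: `h₀ ∈ H_D`, the maximum of
`Δ(h₀; f)` over `f ∈ D` is attained, and
`max_{f ∈ D} Δ(h₀; f) = min_{h ∈ H_D} sup_{f ∈ D} Δ(h; f)`. -/
def IsMinimaxCharacteristic (α : ℝ) (N : ℕ) (a : ℕ → ℂ) (D : Set (ℝ → ℝ)) (h₀ : ℝ → ℂ) : Prop :=
  h₀ ∈ minimaxSpace α N D ∧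
    (∃ f₁ ∈ D, ∀ f ∈ D, estError α N a h₀ f ≤ estError α N a h₀ f₁) ∧
    ∀ h ∈ minimaxSpace α N D, (⨆ f ∈ D, estError α N a h₀ f) ≤ (⨆ f ∈ D, estError α N a h f)

/-! ### Linear estimates of `A_N ξ` -/

/-- The functional `A_N ξ = ∑_{j=0}^N a(j) ξ(j)`. -/
def functionalA {Ω : Type*} (N : ℕ) (a : ℕ → ℂ) (ξ : ℤ → Ω → ℂ) (ω : Ω) : ℂ :=
  ∑ j ∈ Finset.range (N + 1), a j * ξ j ω

/-- `η` is the linear estimate with spectral characteristic `h`, based on the values `ξ(j)`,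
`j ∈ ℤ ∖ {0, …, N}`, of a sequence with spectral density `f`. That is, `η` corresponds to `h` under
the isomorphism `ξ(j) ↔ e^{ijθ}`: it is the limit in probability of finite linear combinations of
observed values whose spectral counterparts converge to `h` in `L^α(f dθ)`. -/
def IsLinearEstimate {Ω : Type*} [MeasurableSpace Ω] (α : ℝ) (N : ℕ) (Pr : Measure Ω)
    (ξ : ℤ → Ω → ℂ) (f : ℝ → ℝ) (h : ℝ → ℂ) (η : Ω → ℂ) : Prop :=
  ∃ b : ℕ → ℤ →₀ ℂ, (∀ n, IsObserved N (b n)) ∧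
    Tendsto (fun n => eLpNorm (fun θ => h θ - trigSum (b n) θ) (ENNReal.ofReal α)
      (spectralMeasure f)) atTop (𝓝 0) ∧
    TendstoInMeasure Pr (fun n ω => (b n).sum fun j z => z * ξ j ω) atTop η

end StableInterpolation

end

namespace StableInterpolation

/-! ### Operations on complex symmetric stable random variables -/

section Stable

variable {Ω : Type*} [MeasurableSpace Ω] {α : ℝ} {Pr : Measure Ω}

/-! The proof exhibits a saddle point. Since `f₀ = C |C_N|` a.e., the quotient `f₀⁻¹ C_N` has
constant modulus `1/C`, so `A_N - h(f₀) = K ū` a.e., where `u = C_N / |C_N|` and `K = C^{-1/(α-1)}`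
(`signedPow_eq`). The residual has constant modulus `K`, hence `Δ(h(f₀); f) = K^α P` for every `f`
in the class: `h(f₀)` equalizes the errors.

The hypothesis on the integrals says that the bounded function `h(f₀)` has no Fourier coefficients
at `0, …, N`. This puts it in `L_N^α(f)` for every `f` of the class at once
(`mem_observedSpace_of_bounded`).

Optimality at `f₀` is a duality argument. As `f₀ u = C · C_N` contains only frequencies `-k` with `0
≤ k ≤ N`, the functional `g ↦ ∫ g u f₀` annihilates `L_N^α(f₀)` (`integral_mul_phaseC_eq_zero`), so
`∫ (A_N - g) u f₀` has the same value `K P` for all admissible `g`. With `|u| = 1`, convexity of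
`t^α` bounds the error below by `K^α P`, with equality only for `A_N - g = K ū`
(`lintegral_rpow_ge_of_integral_mul_eq`). Equalization together with this bound yields both least
favorability and the minimax property.

The probabilistic clause rests on three closure properties of the covariation norm: scaling,
independent sums, and limits in probability. They carry the Stieltjes sums of `Z` to finite
combinations of the `ξ(j)`, and those to the estimation error. -/

lemma continuous_abs_inner_rpow (hα : 0 ≤ α) (w : ℂ) :
    Continuous fun s : Metric.sphere (0 : ℂ) 1 => |inner ℝ (s : ℂ) w| ^ α := by
  have h : Continuous fun s : Metric.sphere (0 : ℂ) 1 => |inner ℝ (s : ℂ) w| := by fun_prop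
  exact h.rpow_const fun _ => Or.inr hα

lemma HasCovariationNormPow.aemeasurable {X : Ω → ℂ} {v : ℝ≥0∞}
    (h : HasCovariationNormPow α Pr X v) : AEMeasurable X Pr := by
  obtain ⟨Γ, hΓ, -⟩ := h
  exact hΓ.aemeasurable

lemma exists_unit_mul_eq (z : ℂ) : ∃ u : ℂ, ‖u‖ = 1 ∧ (‖z‖ : ℂ) * u = z := by
  by_cases hz : z = 0
  · exact ⟨1, by simp, by simp [hz]⟩
  · have : (‖z‖ : ℂ) ≠ 0 := by simpa using hz
    exact ⟨z / ‖z‖, by simp [hz], by field_simp⟩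

/-- On `ℂ = ℝ²` the adjoint of multiplication by `z` is multiplication by `conj z`. -/
lemma charFun_map_const_mul_eq {X : Ω → ℂ} (hX : AEMeasurable X Pr) (z w : ℂ) :
    charFun (Pr.map fun ω => z * X ω) w = charFun (Pr.map X) (conj z * w) := by
  rw [charFun_apply, charFun_apply, integral_map (by fun_prop) (by fun_prop),
    integral_map (by fun_prop) (by fun_prop)]
  congr with ω
  congr 3
  simp [Complex.inner]
  ring

/-- Write `z = |z| u` with `|u| = 1`. The rotation by `u` moves the spectral measure along the
circle and commutes with `s ↦ -s`; the dilation by `|z|` multiplies its mass by `|z|^α`. -/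
theorem HasCovariationNormPow.const_mul (hα : 0 < α) {X : Ω → ℂ} {v : ℝ≥0∞}
    (h : HasCovariationNormPow α Pr X v) (z : ℂ) :
    HasCovariationNormPow α Pr (fun ω => z * X ω) (‖z‖ₑ ^ α * v) := by
  obtain ⟨Γ, hΓ, rfl⟩ := h
  obtain ⟨u, hu, huz⟩ := exists_unit_mul_eq z
  have := hΓ.finite
  let U : Metric.sphere (0 : ℂ) 1 := ⟨u, by simpa using hu⟩
  have hU : Measurable fun s : Metric.sphere (0 : ℂ) 1 => U * s :=
    (continuous_const.mul continuous_id).measurable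
  have hz : ‖z‖ₑ ^ α = ENNReal.ofReal (‖z‖ ^ α) := by
    rw [← ofReal_norm, ENNReal.ofReal_rpow_of_nonneg (norm_nonneg z) hα.le]
  refine ⟨(‖z‖ₑ ^ α) • Γ.map (fun s => U * s), ⟨?_, ?_, ?_, ?_⟩, ?_⟩
  · exact hΓ.aemeasurable.const_mul z
  · rw [hz]
    exact Measure.smul_finite _ (by simp)
  · rw [Measure.map_smul, Measure.map_map (by fun_prop) hU]
    conv_rhs => rw [← hΓ.symmetric, Measure.map_map hU (by fun_prop)]
    congr 2
    ext s
    simp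
  · intro w
    rw [charFun_map_const_mul_eq hΓ.aemeasurable, hΓ.charFun_eq, integral_smul_measure,
      integral_map hU.aemeasurable (continuous_abs_inner_rpow hα.le w).aestronglyMeasurable, hz,
      ENNReal.toReal_ofReal (by positivity), smul_eq_mul, ← integral_const_mul]
    congr 3
    congr with s
    rw [← Real.mul_rpow (norm_nonneg _) (abs_nonneg _)]
    congr 1
    conv_lhs => rw [← huz]
    rw [← abs_of_nonneg (norm_nonneg z), ← abs_mul, abs_of_nonneg (norm_nonneg z)]
    congr 1
    simp [Complex.inner, U]
    ring
  · simp [Measure.map_apply hU MeasurableSet.univ]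

/-- Independence makes the characteristic functions multiply, so their exponents, and with them the
spectral measures, add. -/
theorem HasCovariationNormPow.finset_sum (hα : 0 ≤ α) {ι : Type*} {X : ι → Ω → ℂ} {v : ι → ℝ≥0∞}
    (s : Finset ι) (hind : iIndepFun X Pr) (h : ∀ i, HasCovariationNormPow α Pr (X i) (v i)) :
    HasCovariationNormPow α Pr (fun ω => ∑ i ∈ s, X i ω) (∑ i ∈ s, v i) := by
  choose Γ hΓ hv using h
  have hfin := fun i => (hΓ i).finite
  refine ⟨∑ i ∈ s, Γ i, ⟨?_, inferInstance, ?_, ?_⟩, ?_⟩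
  · exact Finset.aemeasurable_fun_sum s fun i _ => (hΓ i).aemeasurable
  · rw [← Measure.mapₗ_apply_of_measurable (by fun_prop), map_sum]
    refine Finset.sum_congr rfl fun i _ => ?_
    rw [Measure.mapₗ_apply_of_measurable (by fun_prop), (hΓ i).symmetric]
  · intro w
    have hint : ∀ i ∈ s, Integrable (fun s : Metric.sphere (0 : ℂ) 1 =>
        |inner ℝ (s : ℂ) w| ^ α) (Γ i) := fun i _ => by
      exact (continuous_abs_inner_rpow hα w).integrable_of_hasCompactSupport
        (HasCompactSupport.of_compactSpace _)
    rw [(hind.restrict _).charFun_map_fun_finsetSum_eq_prod fun i _ => (hΓ i).aemeasurable,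
      Finset.prod_apply, Finset.prod_congr rfl fun i _ => (hΓ i).charFun_eq w,
      ← Complex.exp_sum, integral_finsetSum_measure hint]
    simp
  · simp [hv]

/-- The spectral measures have eventually bounded mass on a compact space, so they have a weak
cluster point. Symmetry, total mass and the integrals of `|⟨s, w⟩|^α` are all tested by continuous
functions and pass to it. Working along an ultrafilter avoids both subsequences and uniqueness of
the spectral measure. -/
theorem HasCovariationNormPow.of_tendstoInMeasure [IsProbabilityMeasure Pr] (hα : 0 ≤ α)
    {X : ℕ → Ω → ℂ} {Y : Ω → ℂ} {v : ℕ → ℝ≥0∞} {v' : ℝ≥0∞} (hv' : v' ≠ ∞)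
    (hv : Tendsto v atTop (𝓝 v')) (h : ∀ n, HasCovariationNormPow α Pr (X n) (v n))
    (hX : TendstoInMeasure Pr X atTop Y) : HasCovariationNormPow α Pr Y v' := by
  have hYm := hX.aemeasurable fun n => (h n).aemeasurable
  choose Γ hΓ hmass using h
  have hfin := fun i => (hΓ i).finite
  let G : ℕ → FiniteMeasure (Metric.sphere (0 : ℂ) 1) := fun n => ⟨Γ n, hfin n⟩
  let U : Ultrafilter ℕ := Ultrafilter.of atTop
  have hU : (U : Filter ℕ) ≤ atTop := Ultrafilter.of_le atTop
  have hbound : ∀ᶠ n in atTop, v n < v' + 1 :=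
    hv.eventually_lt_const (ENNReal.lt_add_right hv' one_ne_zero)
  have hcpt := isCompact_setOfPred_finiteMeasure_le_of_compactSpace (Metric.sphere (0 : ℂ) 1)
    (v' + 1).toNNReal
  obtain ⟨ν, -, hν⟩ := hcpt.ultrafilter_le_nhds (U.map G) (by
    rw [le_principal_iff]
    refine hU (hbound.mono fun n hn => ?_)
    show (G n).mass ≤ _
    rw [← ENNReal.coe_le_coe, ENNReal.coe_toNNReal (by finiteness), FiniteMeasure.ennreal_mass]
    simpa [G, hmass n] using hn.le)
  have hν : Tendsto G U (𝓝 ν) := hν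
  have hint : ∀ g : Metric.sphere (0 : ℂ) 1 → ℝ, Continuous g →
      Tendsto (fun n => ∫ s, g s ∂(Γ n)) U (𝓝 (∫ s, g s ∂(ν : Measure _))) := fun g hg =>
    FiniteMeasure.tendsto_iff_forall_integral_tendsto.1 hν
      (BoundedContinuousFunction.mkOfCompact ⟨g, hg⟩)
  refine ⟨ν, ⟨hYm, inferInstance, ?_, ?_⟩, ?_⟩
  · refine ext_of_forall_integral_eq_of_IsFiniteMeasure fun g => ?_
    rw [integral_map (by fun_prop) (by fun_prop)]
    refine tendsto_nhds_unique (hint (fun s => g (-s)) (by fun_prop)) ?_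
    refine (hint g g.continuous).congr fun n => ?_
    conv_lhs => rw [← (hΓ n).symmetric]
    rw [integral_map (by fun_prop) (by fun_prop)]
  · intro w
    have h1 := ProbabilityMeasure.tendsto_iff_tendsto_charFun.1
      (hX.tendstoInDistribution fun n => (hΓ n).aemeasurable).tendsto w
    refine tendsto_nhds_unique (h1.mono_left hU) ?_
    have h2 := ((Complex.continuous_ofReal.tendsto _).comp
      (hint _ (continuous_abs_inner_rpow hα w))).neg.cexp
    exact h2.congr fun n => ((hΓ n).charFun_eq w).symm
  · have h1 : Tendsto (fun n => ((G n).mass : ℝ≥0∞)) U (𝓝 (ν.mass : ℝ≥0∞)) :=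
      ENNReal.tendsto_coe.2 ((FiniteMeasure.continuous_mass.tendsto ν).comp hν)
    rw [FiniteMeasure.ennreal_mass] at h1
    refine tendsto_nhds_unique h1 ((hv.mono_left hU).congr fun n => ?_)
    rw [FiniteMeasure.ennreal_mass, ← hmass n]
    rfl

end Stable

/-! ### Linear operations and convergence in measure -/

section TendstoInMeasure

variable {Ω ι κ : Type*} [MeasurableSpace Ω] {μ : Measure Ω} {l : Filter ι}

lemma tendstoInMeasure_const_self (X : Ω → ℂ) : TendstoInMeasure μ (fun _ : ι => X) l X := by
  intro ε hε
  simpa [hε.ne'] using tendsto_const_nhds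

lemma tendstoInMeasure_add {X Y : ι → Ω → ℂ} {X' Y' : Ω → ℂ}
    (hX : TendstoInMeasure μ X l X') (hY : TendstoInMeasure μ Y l Y') :
    TendstoInMeasure μ (fun n ω => X n ω + Y n ω) l (fun ω => X' ω + Y' ω) := by
  rw [tendstoInMeasure_iff_norm] at *
  intro ε hε
  have h := (hX (ε / 2) (by positivity)).add (hY (ε / 2) (by positivity))
  rw [add_zero] at h
  refine tendsto_of_tendsto_of_tendsto_of_le_of_le tendsto_const_nhds h (fun _ => zero_le) ?_
  refine fun n => (measure_mono fun ω hω => ?_).trans (measure_union_le _ _)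
  by_contra hcon
  simp only [Set.mem_union, Set.mem_ofPred_eq, not_or, not_le] at hcon hω
  have := norm_add_le (X n ω - X' ω) (Y n ω - Y' ω)
  rw [sub_add_sub_comm] at this
  linarith [hcon.1, hcon.2]

lemma tendstoInMeasure_const_mul {X : ι → Ω → ℂ} {X' : Ω → ℂ} (z : ℂ)
    (hX : TendstoInMeasure μ X l X') :
    TendstoInMeasure μ (fun n ω => z * X n ω) l (fun ω => z * X' ω) := by
  rcases eq_or_ne z 0 with rfl | hz
  · simpa using tendstoInMeasure_const_self (μ := μ) (l := l) (fun _ : Ω => (0 : ℂ))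
  rw [tendstoInMeasure_iff_norm] at *
  intro ε hε
  have hz' : 0 < ‖z‖ := norm_pos_iff.2 hz
  convert! hX (ε / ‖z‖) (by positivity) using 5 with n ω
  rw [← mul_sub, norm_mul, div_le_iff₀' hz']

lemma tendstoInMeasure_finset_sum {X : κ → ι → Ω → ℂ} {X' : κ → Ω → ℂ} (s : Finset κ)
    (hX : ∀ k ∈ s, TendstoInMeasure μ (X k) l (X' k)) :
    TendstoInMeasure μ (fun n ω => ∑ k ∈ s, X k n ω) l (fun ω => ∑ k ∈ s, X' k ω) := by
  classical
  induction s using Finset.induction_on with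
  | empty => simpa using tendstoInMeasure_const_self (μ := μ) (l := l) (fun _ : Ω => (0 : ℂ))
  | insert k s hk ih =>
    simp only [Finset.sum_insert hk]
    exact tendstoInMeasure_add (hX k (by simp)) (ih fun j hj => hX j (by simp [hj]))

end TendstoInMeasure

/-! ### Riemann sums -/

lemma gridPoint_monotone (m : ℕ) : Monotone fun k : ℕ => -Real.pi + 2 * Real.pi * k / m := by
  intro i j hij
  have : (i : ℝ) ≤ j := by exact_mod_cast hij
  have := Real.pi_pos
  simp only
  gcongr

/-- Uniform continuity of `g` on the closed interval bounds the error on each cell by `ε'` times its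
mass. The half-open cells partition `(-π, π]`, so atoms of `μ` do no harm. -/
lemma tendsto_riemannSum {μ : Measure ℝ} [IsFiniteMeasure μ] {g : ℝ → ℝ} (hg : Continuous g) :
    Tendsto (fun m : ℕ => ∑ k ∈ Finset.range m, g (-Real.pi + 2 * Real.pi * k / m) *
        μ.real (Set.Ioc (-Real.pi + 2 * Real.pi * k / m) (-Real.pi + 2 * Real.pi * (k + 1) / m)))
      atTop (𝓝 (∫ θ in Set.Ioc (-Real.pi) Real.pi, g θ ∂μ)) := by
  have hpi := Real.pi_pos
  rw [Metric.tendsto_atTop]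
  intro ε hε
  set M := μ.real Set.univ
  have hM : 0 ≤ M := measureReal_nonneg
  -- The `+ 1` keeps the denominator positive when `μ = 0`.
  set ε' := ε / (M + 1)
  have hε' : 0 < ε' := by positivity
  have hε'' : ε' * M < ε := by
    have : ε' * (M + 1) = ε := by simp only [ε']; field_simp
    nlinarith
  have huc := (isCompact_Icc (a := -Real.pi) (b := Real.pi)).uniformContinuousOn_of_continuous
    hg.continuousOn
  obtain ⟨δ, hδ, hgδ⟩ := Metric.uniformContinuousOn_iff.1 huc ε' hε'
  obtain ⟨m₀, hm₀⟩ := exists_nat_gt (2 * Real.pi / δ)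
  refine ⟨m₀ + 1, fun m hm => ?_⟩
  have hmpos : (0 : ℝ) < m := by
    have : 0 < m := by omega
    exact_mod_cast this
  have hmesh : 2 * Real.pi / m < δ := by
    have : (m₀ : ℝ) ≤ m := by exact_mod_cast (by omega : m₀ ≤ m)
    rw [div_lt_iff₀ hδ] at hm₀
    rw [div_lt_iff₀ hmpos]
    nlinarith
  set t : ℕ → ℝ := fun k => -Real.pi + 2 * Real.pi * k / m with ht
  have htmono : Monotone t := gridPoint_monotone m
  have ht0 : t 0 = -Real.pi := by simp [ht]
  have htm : t m = Real.pi := by simp only [ht]; field_simp; ring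
  have hts : ∀ k : ℕ, t (k + 1) = t k + 2 * Real.pi / m := fun k => by
    simp only [ht]; push_cast; field_simp; ring
  have hsum : ∀ G : ℝ → ℝ, Continuous G → ∫ θ in Set.Ioc (-Real.pi) Real.pi, G θ ∂μ =
      ∑ k ∈ Finset.range m, ∫ θ in Set.Ioc (t k) (t (k + 1)), G θ ∂μ := fun G hG => by
    rw [← intervalIntegral.integral_of_le (by linarith), ← ht0, ← htm,
      ← intervalIntegral.sum_integral_adjacent_intervals
        fun k _ => hG.intervalIntegrable _ _]
    exact Finset.sum_congr rfl fun k _ => intervalIntegral.integral_of_le (htmono (by simp))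
  have hmass : ∑ k ∈ Finset.range m, μ.real (Set.Ioc (t k) (t (k + 1))) ≤ M := by
    have := hsum (fun _ => 1) continuous_const
    simp only [integral_const, smul_eq_mul, mul_one, measureReal_restrict_apply,
      MeasurableSet.univ, Set.univ_inter] at this
    rw [← this]
    exact measureReal_mono (Set.subset_univ _)
  have hI : ∀ k : ℕ, t k = -Real.pi + 2 * Real.pi * k / m := fun k => rfl
  have hI' : ∀ k : ℕ, t (k + 1) = -Real.pi + 2 * Real.pi * (k + 1) / m := fun k => by simp [ht]
  simp only [← hI', ← hI]
  rw [hsum g hg, Real.dist_eq, ← Finset.sum_sub_distrib]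
  refine lt_of_le_of_lt ((Finset.abs_sum_le_sum_abs _ _).trans ?_) hε''
  calc _ ≤ ∑ k ∈ Finset.range m, ε' * μ.real (Set.Ioc (t k) (t (k + 1))) := ?_
    _ ≤ ε' * M := by rw [← Finset.mul_sum]; gcongr
  refine Finset.sum_le_sum fun k hk => ?_
  have hkm : k + 1 ≤ m := by simpa using hk
  have h1 : g (t k) * μ.real (Set.Ioc (t k) (t (k + 1))) -
      ∫ θ in Set.Ioc (t k) (t (k + 1)), g θ ∂μ =
      ∫ θ in Set.Ioc (t k) (t (k + 1)), (g (t k) - g θ) ∂μ := by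
    rw [integral_sub (integrable_const _) (hg.integrableOn_Ioc)]
    simp [mul_comm]
  rw [h1, ← Real.norm_eq_abs]
  refine norm_setIntegral_le_of_norm_le_const (measure_lt_top _ _) fun θ hθ => ?_
  have htk : -Real.pi ≤ t k := ht0 ▸ htmono (Nat.zero_le k)
  have htk' : t (k + 1) ≤ Real.pi := htm ▸ htmono hkm
  rw [← dist_eq_norm]
  refine (hgδ _ ⟨htk, (htmono (Nat.le_succ k)).trans htk'⟩ _
    ⟨htk.trans hθ.1.le, hθ.2.trans htk'⟩ ?_).le
  rw [Real.dist_eq, abs_sub_comm, abs_of_pos (by linarith [hθ.1])]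
  linarith [hθ.2, hts k]

/-! ### The spectral measure -/

lemma spectralMeasure_eq_restrict (f : ℝ → ℝ) :
    (spectralMeasure f).restrict (Set.Ioc (-Real.pi) Real.pi) = spectralMeasure f := by
  rw [spectralMeasure, restrict_withDensity measurableSet_Ioc, Measure.restrict_restrict
    measurableSet_Ioc, Set.inter_self]

lemma isFiniteMeasure_spectralMeasure {f : ℝ → ℝ} {P : ℝ} (hf : f ∈ densityClass P) :
    IsFiniteMeasure (spectralMeasure f) := by
  have h := hf.1.lintegral_lt_top
  exact isFiniteMeasure_withDensity h.ne

lemma continuous_trigSum (b : ℤ →₀ ℂ) : Continuous (trigSum b) := by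
  unfold trigSum Finsupp.sum
  fun_prop

lemma stieltjesSum_trigSum {Ω : Type*} (Z : ℝ → Ω → ℂ) (b : ℤ →₀ ℂ) (m : ℕ) (ω : Ω) :
    stieltjesSum Z (trigSum b) m ω = ∑ j ∈ b.support,
      b j * stieltjesSum Z (fun θ => Complex.exp (j * θ * Complex.I)) m ω := by
  simp only [stieltjesSum, trigSum, Finsupp.sum, Finset.mul_sum, Finset.sum_mul]
  rw [Finset.sum_comm]
  exact Finset.sum_congr rfl fun j _ => Finset.sum_congr rfl fun k _ => by ring

/-- A finite linear combination of the values of a harmonizable stable sequence is symmetric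
stable, and its covariation norm is the `L^α` norm of its spectral counterpart. -/
theorem IsHarmonizableStable.hasCovariationNormPow_sum {Ω : Type*} [MeasurableSpace Ω] {α P : ℝ}
    (hα : 0 < α) {Pr : Measure Ω} [IsProbabilityMeasure Pr] {ξ : ℤ → Ω → ℂ} {f : ℝ → ℝ}
    (hf : f ∈ densityClass P) (hξ : IsHarmonizableStable α Pr ξ f) (b : ℤ →₀ ℂ) :
    HasCovariationNormPow α Pr (fun ω => b.sum fun j z => z * ξ j ω)
      (∫⁻ θ, ‖trigSum b θ‖ₑ ^ α ∂(spectralMeasure f)) := by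
  have := isFiniteMeasure_spectralMeasure hf
  obtain ⟨Z, -, hindep, hincr, hlim⟩ := hξ
  have hcont : Continuous fun θ => ‖trigSum b θ‖ ^ α :=
    (continuous_trigSum b).norm.rpow_const fun _ => Or.inr hα.le
  have hint : Integrable (fun θ => ‖trigSum b θ‖ ^ α) (spectralMeasure f) := by
    rw [← spectralMeasure_eq_restrict]
    exact hcont.integrableOn_Ioc
  have henorm : ∀ θ, ‖trigSum b θ‖ₑ ^ α = ENNReal.ofReal (‖trigSum b θ‖ ^ α) := fun θ => by
    rw [← ofReal_norm, ENNReal.ofReal_rpow_of_nonneg (norm_nonneg _) hα.le]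
  have htotal : ∫⁻ θ, ‖trigSum b θ‖ₑ ^ α ∂(spectralMeasure f) =
      ENNReal.ofReal (∫ θ in Set.Ioc (-Real.pi) Real.pi, ‖trigSum b θ‖ ^ α
        ∂(spectralMeasure f)) := by
    rw [spectralMeasure_eq_restrict, ofReal_integral_eq_lintegral_ofReal hint
      (Eventually.of_forall fun θ => by positivity)]
    simp only [henorm]
  rw [htotal]
  -- The Stieltjes sums of the trigonometric polynomial are sums of independent scaled increments.
  -- Their covariation norms are Riemann sums of `|trigSum b|^α` against the spectral measure.
  refine HasCovariationNormPow.of_tendstoInMeasure hα.le (X := stieltjesSum Z (trigSum b))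
    ENNReal.ofReal_ne_top (ENNReal.tendsto_ofReal (tendsto_riemannSum hcont)) (fun m => ?_) ?_
  · have hstep : ∀ k : ℕ, HasCovariationNormPow α Pr
        (fun ω => trigSum b (-Real.pi + 2 * Real.pi * k / m) *
          (Z (-Real.pi + 2 * Real.pi * (k + 1) / m) ω - Z (-Real.pi + 2 * Real.pi * k / m) ω))
        (ENNReal.ofReal (‖trigSum b (-Real.pi + 2 * Real.pi * k / m)‖ ^ α *
          (spectralMeasure f).real (Set.Ioc (-Real.pi + 2 * Real.pi * k / m)
            (-Real.pi + 2 * Real.pi * (k + 1) / m)))) := fun k => by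
      rw [ENNReal.ofReal_mul (by positivity), ← henorm, ofReal_measureReal]
      refine (hincr _ _ ?_).const_mul hα _
      simpa using gridPoint_monotone m (Nat.le_succ k)
    rw [ENNReal.ofReal_sum_of_nonneg fun k _ => by positivity]
    refine HasCovariationNormPow.finset_sum hα.le _ ?_ hstep
    have h := (hindep.nat (gridPoint_monotone m)).comp
      (fun k x => trigSum b (-Real.pi + 2 * Real.pi * k / m) * x) fun k => by fun_prop
    convert! h using 3 with k ω
    simp
  · have h := tendstoInMeasure_finset_sum b.support fun j _ =>
      tendstoInMeasure_const_mul (b j) (hlim j)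
    simp only [← stieltjesSum_trigSum] at h
    exact h

/-- The coefficients of `A_N` as a function on `ℤ`. -/
noncomputable def coeffA (N : ℕ) (a : ℕ → ℂ) : ℤ →₀ ℂ :=
  ∑ j ∈ Finset.range (N + 1), Finsupp.single (j : ℤ) (a j)

lemma coeffA_sum (N : ℕ) (a : ℕ → ℂ) (φ : ℤ → ℂ) :
    (coeffA N a).sum (fun j z => z * φ j) = ∑ j ∈ Finset.range (N + 1), a j * φ j := by
  rw [coeffA, ← Finsupp.sum_finsetSum_index (by simp) (fun _ _ _ => add_mul _ _ _)]
  exact Finset.sum_congr rfl fun j _ => Finsupp.sum_single_index (by simp)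

lemma trigSum_coeffA (N : ℕ) (a : ℕ → ℂ) (θ : ℝ) : trigSum (coeffA N a) θ = polyA N a θ := by
  rw [trigSum, coeffA_sum N a fun j => Complex.exp (j * θ * Complex.I), polyA]
  simp

lemma continuous_polyA (N : ℕ) (a : ℕ → ℂ) : Continuous (polyA N a) := by
  unfold polyA
  fun_prop

lemma sub_sum_mul (b b' : ℤ →₀ ℂ) (φ : ℤ → ℂ) :
    (b - b').sum (fun j z => z * φ j) =
      b.sum (fun j z => z * φ j) - b'.sum (fun j z => z * φ j) :=
  Finsupp.sum_sub_index fun _ _ _ => sub_mul _ _ _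

lemma trigSum_sub (b b' : ℤ →₀ ℂ) (θ : ℝ) :
    trigSum (b - b') θ = trigSum b θ - trigSum b' θ :=
  sub_sum_mul b b' _

lemma lintegral_enorm_rpow_eq {α : ℝ} (hα : 0 < α) (μ : Measure ℝ) (g : ℝ → ℂ) :
    ∫⁻ θ, ‖g θ‖ₑ ^ α ∂μ = eLpNorm g (ENNReal.ofReal α) μ ^ α := by
  rw [eLpNorm_eq_lintegral_rpow_enorm_toReal (by simpa) (by simp), ENNReal.toReal_ofReal hα.le,
    ← ENNReal.rpow_mul, one_div, inv_mul_cancel₀ hα.ne', ENNReal.rpow_one]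

lemma memLp_polyA {P : ℝ} {f : ℝ → ℝ} (hf : f ∈ densityClass P) (N : ℕ) (a : ℕ → ℂ) (p : ℝ≥0∞) :
    MemLp (polyA N a) p (spectralMeasure f) := by
  have := isFiniteMeasure_spectralMeasure hf
  obtain ⟨B, hB⟩ := isCompact_Icc.exists_bound_of_continuousOn
    (continuous_polyA N a).continuousOn (s := Set.Icc (-Real.pi) Real.pi)
  refine MemLp.of_bound (continuous_polyA N a).aestronglyMeasurable B ?_
  rw [← spectralMeasure_eq_restrict]
  exact (ae_restrict_mem measurableSet_Ioc).mono fun θ hθ => hB θ ⟨hθ.1.le, hθ.2⟩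

/-- Two triangle inequalities squeeze the norm; finiteness of the limit makes the truncated
subtraction in `ℝ≥0∞` continuous. -/
lemma tendsto_eLpNorm_of_tendsto_sub {μ : Measure ℝ} {p : ℝ≥0∞} (hp : 1 ≤ p) {g : ℝ → ℂ}
    {G : ℕ → ℝ → ℂ} (hg : AEStronglyMeasurable g μ) (hG : ∀ n, AEStronglyMeasurable (G n) μ)
    (hfin : eLpNorm g p μ ≠ ∞) (h : Tendsto (fun n => eLpNorm (G n - g) p μ) atTop (𝓝 0)) :
    Tendsto (fun n => eLpNorm (G n) p μ) atTop (𝓝 (eLpNorm g p μ)) := by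
  have h1 : Tendsto (fun n => eLpNorm g p μ - eLpNorm (G n - g) p μ) atTop
      (𝓝 (eLpNorm g p μ - 0)) := ENNReal.Tendsto.sub tendsto_const_nhds h (Or.inl hfin)
  have h2 : Tendsto (fun n => eLpNorm g p μ + eLpNorm (G n - g) p μ) atTop
      (𝓝 (eLpNorm g p μ + 0)) := tendsto_const_nhds.add h
  rw [tsub_zero] at h1
  rw [add_zero] at h2
  refine tendsto_of_tendsto_of_tendsto_of_le_of_le h1 h2 (fun n => ?_) fun n => ?_
  · rw [tsub_le_iff_right]
    have := eLpNorm_sub_le (hG n) ((hG n).sub hg) hp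
    simpa using this
  · have := eLpNorm_add_le hg ((hG n).sub hg) hp
    simpa using this

/-- `Δ(h; f)` is the error of the linear estimate with spectral characteristic `h`. -/
theorem IsLinearEstimate.hasCovariationNormPow_sub {Ω : Type*} [MeasurableSpace Ω] {α P : ℝ}
    (hα : 1 ≤ α) {N : ℕ} (a : ℕ → ℂ) {Pr : Measure Ω} [IsProbabilityMeasure Pr] {ξ : ℤ → Ω → ℂ}
    {f : ℝ → ℝ} (hf : f ∈ densityClass P) (hξ : IsHarmonizableStable α Pr ξ f) {h : ℝ → ℂ}
    (hh : h ∈ observedSpace α N f) {η : Ω → ℂ} (hη : IsLinearEstimate α N Pr ξ f h η) :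
    HasCovariationNormPow α Pr (fun ω => functionalA N a ξ ω - η ω) (estError α N a h f) := by
  have hα0 : 0 < α := by linarith
  obtain ⟨b, -, hb, hlim⟩ := hη
  have hA := memLp_polyA hf N a (ENNReal.ofReal α)
  have hfin := (hA.sub hh.1).eLpNorm_ne_top
  have heq : estError α N a h f =
      eLpNorm (polyA N a - h) (ENNReal.ofReal α) (spectralMeasure f) ^ α :=
    lintegral_enorm_rpow_eq hα0 _ _
  -- The error is the limit in probability of the finite combinations with coefficients `coeffA N a
  -- - b n`, whose spectral counterparts tend to `A_N - h` in `L^α`.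
  refine HasCovariationNormPow.of_tendstoInMeasure hα0.le
    (X := fun n ω => (coeffA N a - b n).sum fun j z => z * ξ j ω)
    (heq ▸ ENNReal.rpow_ne_top_of_nonneg hα0.le hfin) ?_
    (fun n => hξ.hasCovariationNormPow_sum hα0 hf _) ?_
  · simp only [lintegral_enorm_rpow_eq hα0, heq]
    refine ((ENNReal.continuous_rpow_const (y := α)).tendsto _).comp
      (tendsto_eLpNorm_of_tendsto_sub (by simpa) (hA.sub hh.1).1
        (fun n => (continuous_trigSum _).aestronglyMeasurable) hfin (hb.congr fun n => ?_))
    congr 1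
    ext θ
    simp [trigSum_sub, trigSum_coeffA]
  · have h1 := tendstoInMeasure_add (tendstoInMeasure_const_self (functionalA N a ξ))
      (tendstoInMeasure_const_mul (-1) hlim)
    convert! h1 using 2
    · ext ω
      rw [sub_sum_mul, coeffA_sum N a fun j => ξ j ω, functionalA]
      ring
    · ring

/-! ### Approximation by trigonometric polynomials -/

lemma trigSum_eq_of_mem_span {T : ℝ} (hT : T = 2 * Real.pi) {p : C(AddCircle T, ℂ)}
    (hp : p ∈ Submodule.span ℂ (Set.range (@fourier T))) :
    ∃ b : ℤ →₀ ℂ, ∀ θ : ℝ, p (θ : AddCircle T) = trigSum b θ := by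
  obtain ⟨b, rfl⟩ := Finsupp.mem_span_range_iff_exists_finsupp.1 hp
  refine ⟨b, fun θ => ?_⟩
  have hpi : (Real.pi : ℂ) ≠ 0 := by exact_mod_cast Real.pi_ne_zero
  simp only [Finsupp.sum, trigSum, ContinuousMap.coe_sum, Finset.sum_apply,
    ContinuousMap.coe_smul, Pi.smul_apply, smul_eq_mul, fourier_coe_apply, hT]
  refine Finset.sum_congr rfl fun j _ => ?_
  congr 2
  push_cast
  field_simp

/-- Trigonometric polynomials are dense in `L²` of a finite measure on `(-π, π]`. -/
theorem exists_trigSum_eLpNorm_sub_lt {ν : Measure ℝ} [IsFiniteMeasure ν]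
    (hν : ∀ᵐ θ ∂ν, θ ∈ Set.Ioc (-Real.pi) Real.pi) {g : ℝ → ℂ} (hg : MemLp g 2 ν) {ε : ℝ≥0∞}
    (hε : 0 < ε) : ∃ b : ℤ →₀ ℂ, eLpNorm (fun θ => g θ - trigSum b θ) 2 ν < ε := by
  have hpos : Fact (0 < 2 * Real.pi) := ⟨by positivity⟩
  -- The measure is transported to the circle by `q` and recovered by the section `s`, which inverts
  -- `q` on `(-π, π]`. On the circle, continuous functions are dense in `L²` and trigonometric
  -- polynomials are uniformly dense in them.
  let q : ℝ → AddCircle (2 * Real.pi) := fun θ => θ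
  have hq : Measurable q := AddCircle.measurable_mk'
  let s : AddCircle (2 * Real.pi) → ℝ := fun x =>
    (AddCircle.measurableEquivIoc (2 * Real.pi) (-Real.pi) x : ℝ)
  have hs : Measurable s := measurable_subtype_coe.comp (MeasurableEquiv.measurable _)
  have hIoc : Set.Ioc (-Real.pi) (-Real.pi + 2 * Real.pi) = Set.Ioc (-Real.pi) Real.pi := by
    congr 1; ring
  have hsq : ∀ᵐ θ ∂ν, s (q θ) = θ := by
    filter_upwards [hν] with θ hθ
    rw [← hIoc] at hθ
    exact congrArg Subtype.val
      ((AddCircle.equivIoc (2 * Real.pi) (-Real.pi)).apply_symm_apply ⟨θ, hθ⟩)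
  have hmap : (ν.map q).map s = ν := by
    rw [Measure.map_map hs hq, Measure.map_congr (f := s ∘ q) (g := id) hsq, Measure.map_id]
  have hg' : MemLp (g ∘ s) 2 (ν.map q) :=
    hg.comp_measurePreserving ⟨hs, hmap⟩
  have hdense := (ContinuousMap.toLp_denseRange ℂ (ν.map q) ℂ
    (p := 2) (by simp)).topologicalClosure_map_submodule
      (span_fourier_closure_eq_top (T := 2 * Real.pi))
  have hmem : hg'.toLp ∈ closure (((Submodule.span ℂ (Set.range (@fourier (2 * Real.pi)))).map
      (ContinuousMap.toLp 2 (ν.map q) ℂ : _ →L[ℂ] _).toLinearMap :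
        Submodule ℂ (Lp ℂ 2 (ν.map q))) : Set (Lp ℂ 2 (ν.map q))) := by
    rw [← Submodule.topologicalClosure_coe]
    erw [hdense]
    trivial
  obtain ⟨_, ⟨p, hp, rfl⟩, hlt⟩ := EMetric.mem_closure_iff.1 hmem ε hε
  obtain ⟨b, hb⟩ := trigSum_eq_of_mem_span rfl hp
  refine ⟨b, lt_of_eq_of_lt ?_ hlt⟩
  rw [Lp.edist_def]
  have h1 : eLpNorm (fun θ => g θ - trigSum b θ) 2 ν = eLpNorm ((g ∘ s - ⇑p) ∘ q) 2 ν := by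
    refine eLpNorm_congr_ae ?_
    filter_upwards [hsq] with θ hθ
    simp only [Function.comp_apply, Pi.sub_apply, hθ]
    rw [← hb]
  rw [h1, ← eLpNorm_map_measure (hg'.1.sub p.continuous.aestronglyMeasurable) hq.aemeasurable]
  refine eLpNorm_congr_ae ?_
  filter_upwards [hg'.coeFn_toLp, ContinuousMap.coeFn_toLp (p := 2) (𝕜 := ℂ) (ν.map q) p]
    with x h2 h3
  simp only [Pi.sub_apply]
  rw [h2]
  erw [h3]

/-! ### Fourier coefficients -/

lemma integral_exp_int_mul (n : ℤ) :
    ∫ θ in Set.Ioc (-Real.pi) Real.pi, Complex.exp (n * θ * Complex.I) =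
      if n = 0 then (2 * Real.pi : ℂ) else 0 := by
  have hpi := Real.pi_pos
  split_ifs with hn
  · simp [hn, hpi.le]
    ring
  · have hc : (n * Complex.I : ℂ) ≠ 0 := by simp [hn]
    rw [← intervalIntegral.integral_of_le (by linarith)]
    have h1 : ∀ θ : ℝ, Complex.exp (n * θ * Complex.I) = Complex.exp (n * Complex.I * θ) :=
      fun θ => by ring_nf
    simp only [h1]
    rw [integral_exp_mul_complex hc]
    have h2 : (n * Complex.I * (Real.pi : ℝ) : ℂ) =
        n * Complex.I * ((-Real.pi : ℝ) : ℂ) + n * (2 * Real.pi * Complex.I) := by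
      push_cast; ring
    rw [h2, Complex.exp_periodic.int_mul n]
    simp

lemma integrableOn_of_continuous_Ioc {g : ℝ → ℂ} (hg : Continuous g) :
    IntegrableOn g (Set.Ioc (-Real.pi) Real.pi) :=
  hg.integrableOn_Ioc

lemma integral_exp_mul_trigSum (b : ℤ →₀ ℂ) (k : ℤ) :
    ∫ θ in Set.Ioc (-Real.pi) Real.pi, Complex.exp (-(k * θ * Complex.I)) * trigSum b θ =
      2 * Real.pi * b k := by
  have h : ∀ θ : ℝ, Complex.exp (-(k * θ * Complex.I)) * trigSum b θ =
      ∑ j ∈ b.support, b j * Complex.exp (((j - k : ℤ) : ℂ) * θ * Complex.I) := fun θ => by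
    rw [trigSum, Finsupp.sum, Finset.mul_sum]
    refine Finset.sum_congr rfl fun j _ => ?_
    rw [mul_left_comm, ← Complex.exp_add]
    push_cast
    ring_nf
  simp only [h]
  rw [integral_finsetSum _ fun j _ => integrableOn_of_continuous_Ioc (by fun_prop)]
  simp only [integral_const_mul, integral_exp_int_mul, sub_eq_zero]
  simp [mul_comm]

/-- Pairing with `C_N` extracts exactly the coefficients `b 0, …, b N`, which vanish for an observed
polynomial. -/
lemma integral_trigSum_mul_polyC {N : ℕ} (c : ℕ → ℂ) {b : ℤ →₀ ℂ} (hb : IsObserved N b) :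
    ∫ θ in Set.Ioc (-Real.pi) Real.pi, trigSum b θ * polyC N c θ = 0 := by
  have h : ∀ θ : ℝ, trigSum b θ * polyC N c θ = ∑ k ∈ Finset.range (N + 1),
      c k * (Complex.exp (-(((k : ℤ) : ℂ) * θ * Complex.I)) * trigSum b θ) := fun θ => by
    rw [polyC, Finset.mul_sum]
    exact Finset.sum_congr rfl fun k _ => by push_cast; ring
  simp only [h]
  have hc := continuous_trigSum b
  rw [integral_finsetSum _ fun k _ => integrableOn_of_continuous_Ioc (by fun_prop)]
  refine Finset.sum_eq_zero fun k hk => ?_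
  rw [integral_const_mul, integral_exp_mul_trigSum]
  have : b k = 0 := by
    by_contra hne
    refine hb k (by simpa using hne) ⟨by simp, ?_⟩
    have := Finset.mem_range.1 hk
    exact_mod_cast Nat.lt_succ_iff.1 this
  simp [this]

/-! ### Bounded functions in the space of the observations -/

lemma enorm_exp_mul_I (x : ℝ) (n : ℤ) : ‖Complex.exp (n * x * Complex.I)‖ₑ = 1 := by
  have : (n * x * Complex.I : ℂ) = ((n * x : ℝ) : ℂ) * Complex.I := by push_cast; ring
  rw [← ofReal_norm, this, Complex.norm_exp_ofReal_mul_I, ENNReal.ofReal_one]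

lemma spectralMeasure_absolutelyContinuous (f : ℝ → ℝ) :
    spectralMeasure f ≪ volume.restrict (Set.Ioc (-Real.pi) Real.pi) :=
  withDensity_absolutelyContinuous _ _

/-- A trigonometric polynomial close to `h` may use forbidden frequencies. If it is also close in
Lebesgue measure, its coefficients there are small, because those of `h` vanish, and deleting these
finitely many terms costs little. Boundedness puts `h` in `L²` of any finite measure absolutely
continuous with respect to Lebesgue measure on `(-π, π]`, and `α ≤ 2` lets `L²` control `L^α`. -/
theorem mem_observedSpace_of_bounded {α P B : ℝ} (hα₁ : 1 ≤ α) (hα₂ : α ≤ 2) {N : ℕ} {f : ℝ → ℝ}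
    (hf : f ∈ densityClass P) {h : ℝ → ℂ}
    (hm : AEStronglyMeasurable h (volume.restrict (Set.Ioc (-Real.pi) Real.pi)))
    (hB : ∀ᵐ θ ∂(volume.restrict (Set.Ioc (-Real.pi) Real.pi)), ‖h θ‖ ≤ B)
    (hcoef : ∀ k : ℕ, k ≤ N → ∫ θ in Set.Ioc (-Real.pi) Real.pi,
      Complex.exp (-(k * θ * Complex.I)) * h θ = 0) :
    h ∈ observedSpace α N f := by
  classical
  have := isFiniteMeasure_spectralMeasure hf
  have hac := spectralMeasure_absolutelyContinuous f
  set lam := volume.restrict (Set.Ioc (-Real.pi) Real.pi) with hlam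
  -- One approximation in `L²(ν)` controls two things: the Lebesgue part the Fourier coefficients,
  -- the spectral part the distance required.
  set ν := lam + spectralMeasure f with hν
  have hνac : ν ≪ lam := Measure.AbsolutelyContinuous.add_left Measure.AbsolutelyContinuous.rfl hac
  set p := ENNReal.ofReal α with hp
  have hp1 : 1 ≤ p := by simpa [hp] using hα₁
  have hp2 : p ≤ 2 := by
    rw [hp, ← ENNReal.ofReal_ofNat]; exact ENNReal.ofReal_le_ofReal hα₂
  refine ⟨MemLp.of_bound (hm.mono_ac hac) B (hac.ae_le hB), fun ε hε => ?_⟩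
  have hmν : AEStronglyMeasurable h ν := hm.mono_ac hνac
  have h2 : MemLp h 2 ν := MemLp.of_bound hmν B (hνac.ae_le hB)
  set K₁ : ℝ≥0∞ := ν Set.univ ^ (1 / p.toReal - 1 / (2 : ℝ≥0∞).toReal)
  set K₂ : ℝ≥0∞ := ν Set.univ ^ (1 / (1 : ℝ≥0∞).toReal - 1 / (2 : ℝ≥0∞).toReal)
  set K₃ : ℝ≥0∞ := ν Set.univ ^ p.toReal⁻¹
  have hM : ν Set.univ ≠ ∞ := measure_ne_top _ _
  have hpt : p.toReal = α := by simp [hp]; linarith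
  have hK₁ : K₁ ≠ ∞ := ENNReal.rpow_ne_top_of_nonneg (by
    rw [hpt, sub_nonneg]
    simpa using inv_anti₀ (by linarith) hα₂) hM
  have hK₂ : K₂ ≠ ∞ := ENNReal.rpow_ne_top_of_nonneg (by norm_num) hM
  have hK₃ : K₃ ≠ ∞ := ENNReal.rpow_ne_top_of_nonneg (by positivity) hM
  set S := Finset.Icc (0 : ℤ) N
  -- `K₁` passes from `L²` to `L^α`. Each of the `S.card` deleted coefficients is at most `K₂` times
  -- the `L²` error, and `K₃` turns a uniform bound into an `L^α` bound.
  set K : ℝ≥0∞ := K₁ + K₃ * ((S.card : ℝ≥0∞) * K₂) with hK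
  have hKtop : K ≠ ∞ := by finiteness
  obtain ⟨δ, hδ, hδε⟩ := ENNReal.exists_nnreal_pos_mul_lt hKtop hε.ne'
  obtain ⟨b, hb⟩ := exists_trigSum_eLpNorm_sub_lt (ν := ν)
    (hνac.ae_le (ae_restrict_mem measurableSet_Ioc)) h2 (ε := δ) (by simpa using hδ)
  set E := eLpNorm (fun θ => h θ - trigSum b θ) 2 ν with hE
  have hbm : AEStronglyMeasurable (trigSum b) ν := (continuous_trigSum b).aestronglyMeasurable
  have hdiffm : AEStronglyMeasurable (fun θ => h θ - trigSum b θ) ν := hmν.sub hbm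
  -- For `k` in `S`, `-2π b k` is the integral of `e^{-ikθ}` against `h - trigSum b`; the factor `2π
  -- ≥ 1` is discarded.
  have hbk : ∀ k ∈ S, ‖b k‖ₑ ≤ E * K₂ := by
    intro k hk
    obtain ⟨hk0, hkN⟩ := Finset.mem_Icc.1 hk
    obtain ⟨n, rfl⟩ := Int.eq_ofNat_of_zero_le hk0
    have hh := hcoef n (by exact_mod_cast hkN)
    have hb' := integral_exp_mul_trigSum b n
    have hem : Continuous fun θ : ℝ => Complex.exp (-(n * θ * Complex.I)) := by fun_prop
    have hint1 : Integrable (fun θ : ℝ => Complex.exp (-(n * θ * Complex.I)) * h θ) lam := by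
      refine Integrable.of_bound (hem.aestronglyMeasurable.mul hm) B ?_
      filter_upwards [hB] with θ hθ
      have : (-(n * θ * Complex.I) : ℂ) = ((-(n * θ) : ℝ) : ℂ) * Complex.I := by push_cast; ring
      rwa [norm_mul, this, Complex.norm_exp_ofReal_mul_I, one_mul]
    have hint2 : Integrable (fun θ : ℝ => Complex.exp (-(n * θ * Complex.I)) * trigSum b θ) lam :=
      integrableOn_of_continuous_Ioc (hem.mul (continuous_trigSum b))
    have hsub : ∫ θ, Complex.exp (-(n * θ * Complex.I)) * (h θ - trigSum b θ) ∂lam =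
        -(2 * Real.pi * b n) := by
      simp only [mul_sub]
      rw [integral_sub hint1 hint2, hh, zero_sub, ← hb']
      push_cast
      rfl
    have h2pi : (1 : ℝ≥0∞) ≤ ‖(2 * Real.pi : ℂ)‖ₑ := by
      rw [← ofReal_norm, ENNReal.one_le_ofReal]
      have := Real.pi_gt_three
      simp [abs_of_pos Real.pi_pos]
      linarith
    calc ‖b n‖ₑ = 1 * ‖b n‖ₑ := (one_mul _).symm
      _ ≤ ‖(2 * Real.pi : ℂ)‖ₑ * ‖b n‖ₑ := by gcongr
      _ = ‖∫ θ, Complex.exp (-(n * θ * Complex.I)) * (h θ - trigSum b θ) ∂lam‖ₑ := by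
        rw [hsub, enorm_neg, ← enorm_mul]
      _ ≤ ∫⁻ θ, ‖Complex.exp (-(n * θ * Complex.I)) * (h θ - trigSum b θ)‖ₑ ∂lam :=
        enorm_integral_le_lintegral_enorm _
      _ = ∫⁻ θ, ‖h θ - trigSum b θ‖ₑ ∂lam := by
        congr with θ
        have := enorm_exp_mul_I θ (-n)
        rw [enorm_mul]
        push_cast at this
        rw [← neg_mul, ← neg_mul, this, one_mul]
      _ ≤ ∫⁻ θ, ‖h θ - trigSum b θ‖ₑ ∂ν := lintegral_mono' (Measure.le_add_right le_rfl) le_rfl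
      _ = eLpNorm (fun θ => h θ - trigSum b θ) 1 ν := eLpNorm_one_eq_lintegral_enorm.symm
      _ ≤ E * K₂ := eLpNorm_le_eLpNorm_mul_rpow_measure_univ (by norm_num) hdiffm
  set b' := b.filter (· ∉ S) with hb'
  have hbb' : b - b' = b.filter (· ∈ S) := by
    rw [sub_eq_iff_eq_add, hb']
    exact (Finsupp.filter_add_filter_not b _).symm
  refine ⟨b', fun j hj hjN => ?_, lt_of_le_of_lt ?_ hδε⟩
  · rw [hb', Finsupp.support_filter, Finset.mem_filter] at hj
    exact hj.2 (Finset.mem_Icc.2 hjN)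
  have hpoint : ∀ θ, ‖trigSum (b - b') θ‖ₑ ≤ S.card * (E * K₂) := fun θ => by
    rw [hbb', trigSum, Finsupp.sum]
    calc _ ≤ ∑ j ∈ (b.filter (· ∈ S)).support, ‖(b.filter (· ∈ S)) j *
          Complex.exp (j * θ * Complex.I)‖ₑ := enorm_sum_le _ _
      _ ≤ ∑ j ∈ S, ‖b j‖ₑ := by
        have hsup : (b.filter (· ∈ S)).support ⊆ S := fun j hj => by
          rw [Finsupp.support_filter, Finset.mem_filter] at hj
          exact hj.2
        refine (Finset.sum_le_sum_of_subset hsup).trans (Finset.sum_le_sum fun j hj => ?_)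
        rw [enorm_mul, enorm_exp_mul_I, mul_one, Finsupp.filter_apply_pos _ _ hj]
      _ ≤ _ := by
        simpa using Finset.sum_le_sum hbk
  have hsplit : (fun θ => h θ - trigSum b' θ) =
      (fun θ => h θ - trigSum b θ) + trigSum (b - b') := by
    ext θ
    simp [trigSum_sub]
  calc eLpNorm (fun θ => h θ - trigSum b' θ) p (spectralMeasure f)
      ≤ eLpNorm (fun θ => h θ - trigSum b' θ) p ν :=
        eLpNorm_mono_measure _ (Measure.le_add_left le_rfl)
    _ ≤ eLpNorm (fun θ => h θ - trigSum b θ) p ν + eLpNorm (trigSum (b - b')) p ν := by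
        rw [hsplit]
        exact eLpNorm_add_le hdiffm (continuous_trigSum _).aestronglyMeasurable hp1
    _ ≤ E * K₁ + K₃ * (S.card * (E * K₂)) := by
        gcongr
        · exact eLpNorm_le_eLpNorm_mul_rpow_measure_univ hp2 hdiffm
        · refine (eLpNorm_le_of_ae_enorm_bound (ae_of_all _ hpoint)).trans_eq ?_
          rw [smul_eq_mul, mul_comm]
    _ = E * K := by rw [hK]; ring
    _ ≤ δ * K := by gcongr

/-! ### A variational inequality -/

/-- The left side is the tangent at `K` to the strictly convex function `t^α`. After division by
`K^α` this is Bernoulli's inequality at `t / K - 1`, and the equality case is its strict form. -/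
lemma add_mul_sub_le_rpow {α K t : ℝ} (hα : 1 < α) (hK : 0 < K) (ht : 0 ≤ t) :
    K ^ α + α * K ^ (α - 1) * (t - K) ≤ t ^ α ∧
      (K ^ α + α * K ^ (α - 1) * (t - K) = t ^ α → t = K) := by
  have hKα : K ^ (α - 1) * K = K ^ α := by
    rw [← Real.rpow_add_one hK.ne', sub_add_cancel]
  have hs : -1 ≤ t / K - 1 := by
    have : 0 ≤ t / K := by positivity
    linarith
  have hpow : K ^ α * (1 + (t / K - 1)) ^ α = t ^ α := by
    rw [add_sub_cancel, Real.div_rpow ht hK.le]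
    have := (Real.rpow_pos_of_pos hK α).ne'
    field_simp
  have hlin : K ^ α * (1 + α * (t / K - 1)) = K ^ α + α * K ^ (α - 1) * (t - K) := by
    rw [← hKα]; field_simp
  have hpos := Real.rpow_pos_of_pos hK α
  rw [← hpow, ← hlin]
  refine ⟨?_, fun h => ?_⟩
  · gcongr
    exact one_add_mul_self_le_rpow_one_add hs hα.le
  · by_contra hne
    have hs' : t / K - 1 ≠ 0 := by
      intro h0
      rw [sub_eq_zero, div_eq_one_iff_eq hK.ne'] at h0
      exact hne h0
    have := one_add_mul_self_lt_rpow_one_add hs hs' hα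
    exact absurd h (mul_lt_mul_of_pos_left this hpos).ne

/-- A complex number whose real part equals its modulus is real and nonnegative, so `w u = K`;
multiplication by `ū = u⁻¹` gives `w`. -/
lemma eq_ofReal_mul_conj {w u : ℂ} {K : ℝ} (hu : ‖u‖ = 1) (hw : ‖w‖ = K) (h : (w * u).re = K) :
    w = K * conj u := by
  have h1 : w * u = K := by
    have h2 : ‖w * u‖ = (w * u).re := by rw [norm_mul, hu, hw, h, mul_one]
    have h3 := Complex.re_eq_norm.1 h2.symm
    have h4 := (Complex.nonneg_iff.1 h3).2
    apply Complex.ext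
    · simpa using h
    · simpa using h4.symm
  have h5 : u * conj u = 1 := by rw [Complex.mul_conj']; simp [hu]
  calc w = w * (u * conj u) := by rw [h5, mul_one]
    _ = K * conj u := by rw [← mul_assoc, h1]

/-- If `|u| = 1` and `∫ w u dμ = K μ(univ)`, then `∫ |w|^α dμ ≥ K^α μ(univ)`, with equality only for
`w = K ū`. -/
theorem lintegral_rpow_ge_of_integral_mul_eq {X : Type*} [MeasurableSpace X] {μ : Measure X}
    [IsFiniteMeasure μ] {α K : ℝ} (hα : 1 < α) (hK : 0 < K) {w u : X → ℂ}
    (hw : MemLp w (ENNReal.ofReal α) μ) (hum : AEStronglyMeasurable u μ)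
    (hu : ∀ᵐ x ∂μ, ‖u x‖ = 1) (hint : ∫ x, w x * u x ∂μ = K * μ.real Set.univ) :
    ENNReal.ofReal (K ^ α) * μ Set.univ ≤ ∫⁻ x, ‖w x‖ₑ ^ α ∂μ ∧
      (∫⁻ x, ‖w x‖ₑ ^ α ∂μ ≤ ENNReal.ofReal (K ^ α) * μ Set.univ →
        ∀ᵐ x ∂μ, w x = K * conj (u x)) := by
  have hα0 : 0 < α := by linarith
  have hw1 : Integrable w μ := memLp_one_iff_integrable.1 (hw.mono_exponent (by simpa using hα.le))
  have hwu : Integrable (fun x => w x * u x) μ :=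
    hw1.mul_bdd (c := 1) hum (hu.mono fun x hx => hx.le)
  have hre : Integrable (fun x => (w x * u x).re) μ := hwu.re
  have hpow : Integrable (fun x => ‖w x‖ ^ α) μ := by
    have := hw.integrable_norm_rpow (by simpa using hα0) (by simp)
    rwa [ENNReal.toReal_ofReal hα0.le] at this
  have hlint : ∫⁻ x, ‖w x‖ₑ ^ α ∂μ = ENNReal.ofReal (∫ x, ‖w x‖ ^ α ∂μ) := by
    rw [ofReal_integral_eq_lintegral_ofReal hpow (ae_of_all _ fun x => by positivity)]
    congr with x
    rw [← ofReal_norm, ENNReal.ofReal_rpow_of_nonneg (norm_nonneg _) hα0.le]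
  have hmass : ENNReal.ofReal (K ^ α) * μ Set.univ = ENNReal.ofReal (K ^ α * μ.real Set.univ) := by
    rw [ENNReal.ofReal_mul (by positivity), ofReal_measureReal]
  have hsub : Integrable (fun x => α * K ^ (α - 1) * ((w x * u x).re - K)) μ :=
    (hre.sub (integrable_const _)).const_mul _
  have hlinear : Integrable (fun x => K ^ α + α * K ^ (α - 1) * ((w x * u x).re - K)) μ :=
    (integrable_const _).add hsub
  have hlin : ∫ x, (K ^ α + α * K ^ (α - 1) * ((w x * u x).re - K)) ∂μ =
      K ^ α * μ.real Set.univ := by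
    rw [integral_add (integrable_const _) hsub, integral_const_mul, integral_sub hre (integrable_const _)]
    have : ∫ x, (w x * u x).re ∂μ = K * μ.real Set.univ := by
      have h := integral_re hwu
      simp only [RCLike.re_eq_complex_re] at h
      rw [h, hint]
      simp
    rw [this]
    simp
    ring
  have hcoef : 0 < α * K ^ (α - 1) := by positivity
  -- The tangent inequality at `t = |w|` is weakened by `Re (w u) ≤ |w|`, the slope being positive.
  -- The resulting minorant is affine in `Re (w u)`, so `hint` determines its integral.
  have hle : ∀ᵐ x ∂μ, 0 ≤ ‖w x‖ ^ α - (K ^ α + α * K ^ (α - 1) * ((w x * u x).re - K)) := by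
    filter_upwards [hu] with x hx
    have h1 : (w x * u x).re ≤ ‖w x‖ := by
      simpa [norm_mul, hx] using Complex.re_le_norm (w x * u x)
    have h2 := (add_mul_sub_le_rpow hα hK (norm_nonneg (w x))).1
    nlinarith
  have hdiff : ∫ x, (‖w x‖ ^ α - (K ^ α + α * K ^ (α - 1) * ((w x * u x).re - K))) ∂μ =
      ∫ x, ‖w x‖ ^ α ∂μ - K ^ α * μ.real Set.univ := by
    rw [integral_sub hpow hlinear, hlin]
  have hnn := integral_nonneg_of_ae hle
  rw [hdiff] at hnn
  rw [hlint, hmass]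
  refine ⟨ENNReal.ofReal_le_ofReal (by linarith), fun hcon => ?_⟩
  rw [ENNReal.ofReal_le_ofReal_iff (by positivity)] at hcon
  -- Equality of the integrals makes both pointwise inequalities tight a.e.: `Re (w u) = |w|` and
  -- `|w| = K`.
  have hzero := (integral_eq_zero_iff_of_nonneg_ae hle (hpow.sub hlinear)).1
    (by rw [hdiff]; linarith)
  filter_upwards [hzero, hu] with x hx hux
  simp only [Pi.zero_apply] at hx
  have h1 : (w x * u x).re ≤ ‖w x‖ := by
    simpa [norm_mul, hux] using Complex.re_le_norm (w x * u x)
  have h2 := add_mul_sub_le_rpow hα hK (norm_nonneg (w x))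
  have h3 : (w x * u x).re = ‖w x‖ := by
    nlinarith [h2.1]
  rw [h3] at hx
  have h4 := h2.2 (by linarith)
  exact eq_ofReal_mul_conj hux h4 (h3.trans h4)

/-! ### The least favorable density -/

/-- `C_N / |C_N|`. -/
noncomputable def phaseC (N : ℕ) (c : ℕ → ℂ) (θ : ℝ) : ℂ := polyC N c θ / ‖polyC N c θ‖

lemma continuous_polyC (N : ℕ) (c : ℕ → ℂ) : Continuous (polyC N c) := by
  unfold polyC
  fun_prop

lemma measurable_phaseC (N : ℕ) (c : ℕ → ℂ) : Measurable (phaseC N c) := by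
  have := (continuous_polyC N c).measurable
  unfold phaseC
  fun_prop

lemma norm_phaseC_le (N : ℕ) (c : ℕ → ℂ) (θ : ℝ) : ‖phaseC N c θ‖ ≤ 1 := by
  rw [phaseC, norm_div, Complex.norm_real, norm_norm]
  exact div_self_le_one _

lemma norm_phaseC {N : ℕ} {c : ℕ → ℂ} {θ : ℝ} (h : polyC N c θ ≠ 0) : ‖phaseC N c θ‖ = 1 := by
  rw [phaseC, norm_div, Complex.norm_real, norm_norm, div_self (by simpa using h)]

lemma spectralMeasure_univ {f : ℝ → ℝ} {P : ℝ} (hf : f ∈ densityClass P) :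
    spectralMeasure f Set.univ = ENNReal.ofReal P := by
  rw [spectralMeasure, withDensity_apply _ MeasurableSet.univ, Measure.restrict_univ,
    ← ofReal_integral_eq_lintegral_ofReal hf.1 hf.2.1, hf.2.2]

/-- The exponent `-1/(α-1)` is negative, so the integrand is `∞` wherever `ENNReal.ofReal (f θ) =
0`, that is, where `f θ ≤ 0`. -/
lemma ae_pos_of_minimality {α : ℝ} (hα : 1 < α) {f : ℝ → ℝ}
    (hf : IntegrableOn f (Set.Ioc (-Real.pi) Real.pi)) (hmin : Minimality α f) :
    ∀ᵐ θ ∂(volume.restrict (Set.Ioc (-Real.pi) Real.pi)), 0 < f θ := by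
  have hm : AEMeasurable (fun θ => ENNReal.ofReal (f θ) ^ (-1 / (α - 1)))
      (volume.restrict (Set.Ioc (-Real.pi) Real.pi)) :=
    (hf.aestronglyMeasurable.aemeasurable.ennreal_ofReal).pow_const _
  filter_upwards [ae_lt_top' hm hmin.ne] with θ hθ
  by_contra hneg
  rw [ENNReal.ofReal_of_nonpos (not_lt.1 hneg), ENNReal.zero_rpow_of_neg] at hθ
  · exact lt_irrefl _ hθ
  · exact div_neg_of_neg_of_pos (by norm_num) (by linarith)

lemma constant_pos {f : ℝ → ℝ} {C : ℝ} {N : ℕ} {c : ℕ → ℂ}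
    (hpos : ∀ᵐ θ ∂(volume.restrict (Set.Ioc (-Real.pi) Real.pi)), 0 < f θ)
    (hform : ∀ᵐ θ ∂(volume.restrict (Set.Ioc (-Real.pi) Real.pi)), f θ = C * ‖polyC N c θ‖) :
    0 < C := by
  have hne : NeBot (ae (volume.restrict (Set.Ioc (-Real.pi) Real.pi))) := by
    rw [ae_neBot, Ne, Measure.restrict_eq_zero, Real.volume_Ioc, ENNReal.ofReal_eq_zero]
    linarith [Real.pi_pos]
  obtain ⟨θ, h1, h2⟩ := (hpos.and hform).exists
  rw [h2] at h1
  exact pos_of_mul_pos_left h1 (norm_nonneg _)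

/-- The quotient `f⁻¹ C_N` has modulus `C⁻¹` independently of `θ`, so the signed power keeps only
the conjugate phase, with a constant factor. -/
lemma signedPow_eq {α C : ℝ} {N : ℕ} {c : ℕ → ℂ} (hC : 0 < C) {x θ : ℝ} (hx : 0 < x)
    (hform : x = C * ‖polyC N c θ‖) :
    signedPow ((x⁻¹ : ℝ) * polyC N c θ) (1 / (α - 1)) =
      ((C⁻¹ ^ (1 / (α - 1)) : ℝ) : ℂ) * conj (phaseC N c θ) := by
  have hc : 0 < ‖polyC N c θ‖ := by
    rw [hform] at hx
    exact pos_of_mul_pos_right hx hC.le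
  have hnorm : ‖((x⁻¹ : ℝ) : ℂ) * polyC N c θ‖ = C⁻¹ := by
    rw [norm_mul, Complex.norm_real, Real.norm_of_nonneg (by positivity), hform]
    field_simp
  have hCi : 0 < C⁻¹ := by positivity
  have hpow : C⁻¹ ^ (1 / (α - 1)) = C⁻¹ ^ (1 / (α - 1) - 1) * C⁻¹ := by
    rw [← Real.rpow_add_one hCi.ne', sub_add_cancel]
  rw [signedPow, hnorm, hpow, phaseC, hform]
  have hC' : (C : ℂ) ≠ 0 := by exact_mod_cast hC.ne'
  have hc' : (‖polyC N c θ‖ : ℂ) ≠ 0 := by exact_mod_cast hc.ne'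
  simp only [map_mul, map_div₀, Complex.conj_ofReal]
  push_cast
  field_simp

lemma integral_spectralMeasure {f : ℝ → ℝ} {P : ℝ} (hf : f ∈ densityClass P) (g : ℝ → ℂ) :
    ∫ θ, g θ ∂(spectralMeasure f) = ∫ θ in Set.Ioc (-Real.pi) Real.pi, (f θ : ℂ) * g θ := by
  rw [spectralMeasure, integral_withDensity_eq_integral_toReal_smul₀
    hf.1.aestronglyMeasurable.aemeasurable.ennreal_ofReal (by simp)]
  refine integral_congr_ae ?_
  filter_upwards [hf.2.1] with θ hθ
  simp [ENNReal.toReal_ofReal hθ]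

/-- The special form of `f` enters here: `f · C_N / |C_N| = C · C_N` a.e., which is orthogonal to
every observed trigonometric polynomial. Since the phase is bounded, the pairing is continuous in
`L^α(f dθ)` and vanishes on the closed span. -/
lemma integral_mul_phaseC_eq_zero {α P C : ℝ} (hα : 1 ≤ α) {N : ℕ} {c : ℕ → ℂ} {f : ℝ → ℝ}
    (hf : f ∈ densityClass P)
    (hform : ∀ᵐ θ ∂(volume.restrict (Set.Ioc (-Real.pi) Real.pi)), f θ = C * ‖polyC N c θ‖)
    {g : ℝ → ℂ} (hg : g ∈ observedSpace α N f) :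
    ∫ θ, g θ * phaseC N c θ ∂(spectralMeasure f) = 0 := by
  have := isFiniteMeasure_spectralMeasure hf
  set μ := spectralMeasure f
  have hp : 1 ≤ ENNReal.ofReal α := by simpa using hα
  have hub : ∀ᵐ θ ∂μ, ‖phaseC N c θ‖ ≤ 1 := ae_of_all _ (norm_phaseC_le N c)
  have hum : AEStronglyMeasurable (phaseC N c) μ := (measurable_phaseC N c).aestronglyMeasurable
  have hg1 : Integrable g μ := memLp_one_iff_integrable.1 (hg.1.mono_exponent hp)
  have hpoly : ∀ b : ℤ →₀ ℂ, IsObserved N b → ∫ θ, trigSum b θ * phaseC N c θ ∂μ = 0 := by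
    intro b hb
    rw [integral_spectralMeasure hf]
    have : ∫ θ in Set.Ioc (-Real.pi) Real.pi, (f θ : ℂ) * (trigSum b θ * phaseC N c θ) =
        ∫ θ in Set.Ioc (-Real.pi) Real.pi, (C : ℂ) * (trigSum b θ * polyC N c θ) := by
      refine integral_congr_ae ?_
      filter_upwards [hform] with θ hθ
      rw [hθ, phaseC]
      -- At a zero of `C_N` the phase is `0 / 0 = 0`, and both sides vanish.
      by_cases h0 : polyC N c θ = 0
      · simp [h0]
      · have : (‖polyC N c θ‖ : ℂ) ≠ 0 := by simpa using h0
        push_cast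
        field_simp
    rw [this, integral_const_mul, integral_trigSum_mul_polyC c hb, mul_zero]
  set K : ℝ≥0∞ := μ Set.univ ^ (1 / (1 : ℝ≥0∞).toReal - 1 / (ENNReal.ofReal α).toReal)
  have hK : K ≠ ∞ := ENNReal.rpow_ne_top_of_nonneg (by
    rw [ENNReal.toReal_ofReal (by linarith), sub_nonneg]
    simpa using inv_le_one_of_one_le₀ hα) (measure_ne_top _ _)
  by_contra hne
  obtain ⟨δ, hδ, hδε⟩ := ENNReal.exists_nnreal_pos_mul_lt hK (enorm_ne_zero.2 hne)
  obtain ⟨b, hb, hbδ⟩ := hg.2 δ (by simpa using hδ)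
  have htm : AEStronglyMeasurable (trigSum b) μ := (continuous_trigSum b).aestronglyMeasurable
  have ht1 : Integrable (trigSum b) μ := by
    rw [show μ = μ.restrict (Set.Ioc (-Real.pi) Real.pi) from (spectralMeasure_eq_restrict f).symm]
    exact (continuous_trigSum b).integrableOn_Ioc
  refine absurd hδε (not_lt.2 ?_)
  calc ‖∫ θ, g θ * phaseC N c θ ∂μ‖ₑ
      = ‖∫ θ, (g θ - trigSum b θ) * phaseC N c θ ∂μ‖ₑ := by
        simp only [sub_mul]
        rw [integral_sub (hg1.mul_bdd (c := 1) hum hub) (ht1.mul_bdd (c := 1) hum hub), hpoly b hb,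
          sub_zero]
    _ ≤ ∫⁻ θ, ‖(g θ - trigSum b θ) * phaseC N c θ‖ₑ ∂μ := enorm_integral_le_lintegral_enorm _
    _ ≤ ∫⁻ θ, ‖g θ - trigSum b θ‖ₑ ∂μ := by
        refine lintegral_mono fun θ => ?_
        rw [enorm_mul]
        refine mul_le_of_le_one_right' ?_
        rw [← ofReal_norm, ENNReal.ofReal_le_one]
        exact norm_phaseC_le N c θ
    _ = eLpNorm (fun θ => g θ - trigSum b θ) 1 μ := eLpNorm_one_eq_lintegral_enorm.symm
    _ ≤ eLpNorm (fun θ => g θ - trigSum b θ) (ENNReal.ofReal α) μ * K :=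
        eLpNorm_le_eLpNorm_mul_rpow_measure_univ hp (hg.1.1.sub htm)
    _ ≤ δ * K := by gcongr

end StableInterpolation

theorem mainTheorem6 (α : ℝ) (hα₁ : 1 < α) (hα₂ : α ≤ 2) (N : ℕ) (a c : ℕ → ℂ) (C P : ℝ)
    (f₀ : ℝ → ℝ)
    (hform : ∀ᵐ θ ∂(volume.restrict (Set.Ioc (-Real.pi) Real.pi)),
      f₀ θ = C * ‖StableInterpolation.polyC N c θ‖)
    (hclass : f₀ ∈ StableInterpolation.densityClass P)
    (hmin : StableInterpolation.Minimality α f₀)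
    (heq : ∀ k : ℕ, k ≤ N →
      ∫ θ in Set.Ioc (-Real.pi) Real.pi, Complex.exp (-(k * θ * Complex.I)) *
        (StableInterpolation.polyA N a θ - StableInterpolation.signedPow
          (((f₀ θ)⁻¹ : ℝ) * StableInterpolation.polyC N c θ) (1 / (α - 1))) = 0) :
    -- the spectral characteristic `h(f₀)` is given by the formula, and it is unique
    StableInterpolation.IsOptimalCharacteristic α N a f₀
      (StableInterpolation.spectralCharacteristic α N a c f₀) ∧
    (∀ h : ℝ → ℂ, StableInterpolation.IsOptimalCharacteristic α N a f₀ h →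
      h =ᵐ[StableInterpolation.spectralMeasure f₀]
        StableInterpolation.spectralCharacteristic α N a c f₀) ∧
    -- `f₀` is least favorable and `h(f₀)` is minimax
    StableInterpolation.IsLeastFavorable α N a (StableInterpolation.densityClass P) f₀ ∧
    StableInterpolation.IsMinimaxCharacteristic α N a (StableInterpolation.densityClass P)
      (StableInterpolation.spectralCharacteristic α N a c f₀) ∧
    -- `Δ(h; f)` is the error of the estimate of `A_N ξ` with spectral characteristic `h`
    (∀ f ∈ StableInterpolation.densityClass P,
      ∀ (Ω : Type*) [MeasurableSpace Ω] (Pr : Measure Ω) [IsProbabilityMeasure Pr]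
        (ξ : ℤ → Ω → ℂ), StableInterpolation.IsHarmonizableStable α Pr ξ f →
      ∀ h ∈ StableInterpolation.observedSpace α N f, ∀ η : Ω → ℂ,
        StableInterpolation.IsLinearEstimate α N Pr ξ f h η →
        StableInterpolation.HasCovariationNormPow α Pr
          (fun ω => StableInterpolation.functionalA N a ξ ω - η ω)
          (StableInterpolation.estError α N a h f)) := by
  open StableInterpolation in
  have hα0 : 0 < α := by linarith
  have hpos := ae_pos_of_minimality hα₁ hclass.1 hmin
  have hC := constant_pos hpos hform
  set K : ℝ := C⁻¹ ^ (1 / (α - 1)) with hKdef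
  have hK : 0 < K := by positivity
  set h₀ := spectralCharacteristic α N a c f₀
  have hphi : ∀ᵐ θ ∂(volume.restrict (Set.Ioc (-Real.pi) Real.pi)),
      h₀ θ = polyA N a θ - K * conj (phaseC N c θ) ∧ ‖phaseC N c θ‖ = 1 := by
    filter_upwards [hpos, hform] with θ h1 h2
    refine ⟨congrArg (polyA N a θ - ·) (signedPow_eq hC h1 h2), norm_phaseC fun h0 => ?_⟩
    rw [h2, h0] at h1
    simp at h1
  have hmodel : Measurable fun θ => polyA N a θ - K * conj (phaseC N c θ) := by
    have h1 := (continuous_polyA N a).measurable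
    have h2 := Complex.continuous_conj.measurable.comp (measurable_phaseC N c)
    exact h1.sub (h2.const_mul _)
  have hm : AEStronglyMeasurable h₀ (volume.restrict (Set.Ioc (-Real.pi) Real.pi)) :=
    hmodel.aestronglyMeasurable.congr (hphi.mono fun θ h => h.1.symm)
  obtain ⟨B, hB⟩ := isCompact_Icc.exists_bound_of_continuousOn
    (continuous_polyA N a).continuousOn (s := Set.Icc (-Real.pi) Real.pi)
  have hbound : ∀ᵐ θ ∂(volume.restrict (Set.Ioc (-Real.pi) Real.pi)), ‖h₀ θ‖ ≤ B + K := by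
    filter_upwards [hphi, ae_restrict_mem measurableSet_Ioc] with θ h1 h2
    rw [h1.1]
    refine (norm_sub_le _ _).trans (add_le_add (hB θ ⟨h2.1.le, h2.2⟩) ?_)
    simp [h1.2, abs_of_pos hK]
  have hmem : ∀ f ∈ densityClass P, h₀ ∈ observedSpace α N f := fun f hf =>
    mem_observedSpace_of_bounded hα₁.le hα₂ hf hm hbound heq
  -- Equalizer property: `|A_N - h₀| = K` a.e., so the error sees only the total mass `P` of `f`.
  have herr : ∀ f ∈ densityClass P, estError α N a h₀ f =
      ENNReal.ofReal (K ^ α) * ENNReal.ofReal P := by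
    intro f hf
    rw [← spectralMeasure_univ hf, ← lintegral_const, estError]
    refine lintegral_congr_ae ?_
    filter_upwards [(spectralMeasure_absolutelyContinuous f).ae_le hphi] with θ hθ
    rw [hθ.1, sub_sub_cancel, ← ofReal_norm, ENNReal.ofReal_rpow_of_nonneg (norm_nonneg _) hα0.le]
    simp [hθ.2, abs_of_pos hK]
  have hfin := isFiniteMeasure_spectralMeasure hclass
  have hphi' : ∀ᵐ θ ∂(spectralMeasure f₀),
      h₀ θ = polyA N a θ - K * conj (phaseC N c θ) ∧ ‖phaseC N c θ‖ = 1 :=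
    (spectralMeasure_absolutelyContinuous f₀).ae_le hphi
  have hum : AEStronglyMeasurable (phaseC N c) (spectralMeasure f₀) :=
    (measurable_phaseC N c).aestronglyMeasurable
  -- The pairing of `A_N - g` with the phase does not depend on `g`; it is evaluated at `g = h₀`,
  -- where the integrand is the constant `K |u|² = K`.
  have hdual : ∀ g ∈ observedSpace α N f₀,
      ∫ θ, (polyA N a θ - g θ) * phaseC N c θ ∂(spectralMeasure f₀) =
        K * (spectralMeasure f₀).real Set.univ := by
    have hintg : ∀ g ∈ observedSpace α N f₀,
        Integrable (fun θ => g θ * phaseC N c θ) (spectralMeasure f₀) := fun g hg =>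
      (memLp_one_iff_integrable.1 (hg.1.mono_exponent (by simpa using hα₁.le))).mul_bdd (c := 1) hum
        (ae_of_all _ (norm_phaseC_le N c))
    have hintA : Integrable (fun θ => polyA N a θ * phaseC N c θ) (spectralMeasure f₀) :=
      (memLp_one_iff_integrable.1 (memLp_polyA hclass N a 1)).mul_bdd (c := 1) hum
        (ae_of_all _ (norm_phaseC_le N c))
    have hred : ∀ g ∈ observedSpace α N f₀,
        ∫ θ, (polyA N a θ - g θ) * phaseC N c θ ∂(spectralMeasure f₀) =
          ∫ θ, polyA N a θ * phaseC N c θ ∂(spectralMeasure f₀) := fun g hg => by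
      simp only [sub_mul]
      rw [integral_sub hintA (hintg g hg), integral_mul_phaseC_eq_zero hα₁.le hclass hform hg,
        sub_zero]
    intro g hg
    rw [hred g hg, ← hred h₀ (hmem f₀ hclass)]
    have : ∫ θ, (polyA N a θ - h₀ θ) * phaseC N c θ ∂(spectralMeasure f₀) =
        ∫ _, (K : ℂ) ∂(spectralMeasure f₀) := by
      refine integral_congr_ae ?_
      filter_upwards [hphi'] with θ hθ
      rw [hθ.1, sub_sub_cancel, mul_assoc, mul_comm (conj _), Complex.mul_conj', hθ.2]
      simp
    rw [this]
    simp [mul_comm]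
  have hvar := fun g (hg : g ∈ observedSpace α N f₀) =>
    lintegral_rpow_ge_of_integral_mul_eq hα₁ hK ((memLp_polyA hclass N a _).sub hg.1) hum
      (hphi'.mono fun θ h => h.2) (hdual g hg)
  rw [spectralMeasure_univ hclass] at hvar
  have hlower : ∀ g ∈ observedSpace α N f₀, estError α N a h₀ f₀ ≤ estError α N a g f₀ :=
    fun g hg => (herr f₀ hclass).trans_le (hvar g hg).1
  have hopt : IsOptimalCharacteristic α N a f₀ h₀ := ⟨hmem f₀ hclass, hlower⟩
  refine ⟨hopt, fun h hh => ?_, ⟨hclass, ⟨h₀, hopt⟩, fun f hf => ?_⟩, ⟨?_, ?_, fun h hh => ?_⟩, ?_⟩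
  · have h1 := (hvar h hh.1).2 ((hh.2 h₀ hopt.1).trans_eq (herr f₀ hclass))
    filter_upwards [h1, hphi'] with θ h2 h3
    rw [h3.1, ← h2]
    simp
  · calc optimalError α N a f ≤ estError α N a h₀ f := iInf₂_le h₀ (hmem f hf)
      _ = estError α N a h₀ f₀ := by rw [herr f hf, herr f₀ hclass]
      _ ≤ optimalError α N a f₀ := le_iInf₂ hlower
  · exact Set.mem_iInter₂.2 hmem
  · exact ⟨f₀, hclass, fun f hf => by rw [herr f hf, herr f₀ hclass]⟩
  · refine iSup₂_le fun f hf => ?_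
    -- The constant error of `h₀` equals its error at `f₀`, which by optimality is at most the error
    -- of `h` at `f₀`, hence at most the supremum over the class.
    rw [herr f hf, ← herr f₀ hclass]
    exact (hlower h (Set.mem_iInter₂.1 hh f₀ hclass)).trans
      (le_iSup₂ (f := fun f (_ : f ∈ densityClass P) => estError α N a h f) f₀ hclass)
  · intro f hf Ω _ Pr _ ξ hξ h hh η hη
    exact hη.hasCovariationNormPow_sub hα₁.le a hf hξ hh
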